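/- Let $n\ge 0$ and $h=\lceil n/2\rceil$. A deck of $n$ cards in the order $1,2,\dots,n$ is riffle-shuffled once: it is cut into a first sequence $1,\dots,t$ and a second sequence $t+1,\dots,n$ for some $0\le t\le n$, and the two sequences are interleaved, each keeping its order. The sample space consists of all pairs (cut $t$, interleaving), that is, one of the $\binom nt$ choices of the positions taken by the first sequence; it has $2^n$ elements, and outcomes with different cuts are counted as different even when they give the same permutation. For a quantity $X$ on the sample space let $C[X]$ be the sum of $X$ over all $2^n$ outcomes. At position $i$ of the top half ($1\le i\le h$) the guess is $\lfloor i/2\rfloor+1$, so the guesses are $1,2,2,3,3,4,4,\dots$. Let $Y_i=1$ if the card at position $i$ equals this guess and comes from the first sequence, and $Y_i=0$ otherwise. **Theorem.** For every integer $r\ge 0$ and each parity (even or odd) there are polynomials $P$ and $Q$ with rational coefficients, depending only on $r$ and the parity, of degree at most $\lceil r/2\rceil$ and $\lfloor r/2\rfloor$ respectively, such that for every $n\ge0$ for which $h=\lceil n/2\rceil$ has the given parity, with $L=\lceil h/2\rceil$, $$\sum_{1\le i_1<i_2<\dots<i_r\le h} C[Y_{i_1}Y_{i_2}\cdots Y_{i_r}]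 = 2^n\left[P(L)\binom{2L}{L}\frac1{4^L}+Q(L)\right].$$ -/

import Mathlib

open Finset Polynomial

/-- Number of positions in the top half of a deck of `n` cards, i.e. `⌈n / 2⌉`. -/
def topHalf (n : ℕ) : ℕ := (n + 1) / 2

/-- The sample space of one riffle shuffle of the deck `1, …, n`. An outcome `⟨t, S⟩` records the
cut (the first sequence is `1, …, t`, the second one is `t + 1, …, n`) and the interleaving, given
by the set `S` of those `t` positions among `1, …, n` that receive the cards of the first sequence.
Outcomes with different cuts are different even if they lead to the same permutation. -/
def riffleOutcomes (n : ℕ) : Finset (Σ _ : ℕ, Finset ℕ) :=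
  (range (n + 1)).sigma fun t => powersetCard t (Icc 1 n)

/-- The card at position `p` of the shuffled deck: each of the two sequences keeps its order, so the
`k`-th position of `S` receives the card `k`, and the `k`-th position outside of `S` receives the
card `t + k`. -/
def cardAt (n : ℕ) (ω : Σ _ : ℕ, Finset ℕ) (p : ℕ) : ℕ :=
  if p ∈ ω.2 then #{q ∈ ω.2 | q ≤ p} else ω.1 + #{q ∈ Icc 1 n \ ω.2 | q ≤ p}

/-- The guess made at position `i` of the top half: `1, 2, 2, 3, 3, 4, 4, …`. -/
def topGuess (i : ℕ) : ℕ := i / 2 + 1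

/-- The indicator `Y_i` of the event that the guess at position `i` (of the top half) is correct
and that the card at this position comes from the first sequence. -/
def indicatorY (n i : ℕ) (ω : Σ _ : ℕ, Finset ℕ) : ℕ :=
  if cardAt n ω i = topGuess i ∧ i ∈ ω.2 then 1 else 0

/-- `C[X]`: the sum of `X` over all outcomes of one shuffle of `n` cards. -/
def totalC (n : ℕ) (X : (Σ _ : ℕ, Finset ℕ) → ℕ) : ℕ :=
  ∑ ω ∈ riffleOutcomes n, X ω

/-!
An outcome is the same thing as a set `S ⊆ {1, …, n}` of positions, that is, a walk on `ℤ` whose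
`i`-th step is `+1` if `i ∈ S` and `-1` otherwise. If `#S ∩ {1, …, i} = a`, the walk is at
`2 a - i`, so the guess at position `i` is a correct card of the first sequence exactly when the
`i`-th step goes up from `0` to `1` or from `1` to `2`: these are the marked steps. The sum in
question therefore equals `2 ^ (n - h)` times the number of pairs consisting of a walk of length `h`
from `0` and a set of `r` of its marked steps (`sum_totalC_eq_coeff_markedSeries`).

With weight `x / 2` per step, put `s = √(1 - x²)`, `t = 1 / s` and let `c = (1 - s) / x` be the
generating function of first passages from `1` to `0`. Walks from `i` to `j` have generating
function `t c ^ |i - j|`, and splitting a walk at its first chosen step expresses the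
generating function of walks with `r` chosen steps (`markedSeries`) through the one with `r - 1`
chosen steps. Since the `2 × 2` transfer matrix between the two kinds of marked steps has rank one,
this solves in closed form: for `r ≥ 2` and starting point `0`, the series multiplied by `x` is
`½ t ^ (r + 2) (x (1 - s) ^ (r - 1) (2 - s) + (1 - s) ^ r (2 + s))`, and similarly for `r ≤ 1`
(`exists_X_mul_markedSeries_eq`). As `s` and `t` are even in `x`, the two summands are responsible
for even and odd `h` respectively.

Up to a constant, which affects no coefficient in question, both summands are linear combinations of
`(1 - z) ^ (-k / 2)` with `z = x²` and `1 ≤ k ≤ r + 2`. The coefficient of `z ^ L` in such a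
power is a polynomial in `L` of degree `k / 2 - 1` if `k` is even, and a polynomial of degree
`(k - 1) / 2` times `binom(2 L, L) / 4 ^ L` if `k` is odd (`centralSeries_pow_mem`).
-/

open scoped PowerSeries

noncomputable section

/-! ### Coefficients of half-integral powers of `1 - z` -/

/-- The power series `(1 - z) ^ (-1 / 2)`, given by its coefficients; see
`one_sub_X_mul_centralSeries_sq`. -/
def centralSeries : ℚ⟦X⟧ := PowerSeries.mk fun L => (Nat.choose (2 * L) L : ℚ) / 4 ^ L

/-- The power series `√(1 - z)`, written as `(1 - z) (1 - z) ^ (-1 / 2)`; see `sqrtSeries_sq`. -/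
def sqrtSeries : ℚ⟦X⟧ := (1 - PowerSeries.X) * centralSeries

lemma coeff_centralSeries_succ (L : ℕ) :
    2 * ((L : ℚ) + 1) * PowerSeries.coeff (L + 1) centralSeries =
      (2 * L + 1) * PowerSeries.coeff L centralSeries := by
  simp only [centralSeries, PowerSeries.coeff_mk]
  have h := Nat.succ_mul_centralBinom_succ L
  simp only [Nat.centralBinom] at h
  have h' : ((L : ℚ) + 1) * (Nat.choose (2 * (L + 1)) (L + 1) : ℚ) =
      2 * (2 * L + 1) * Nat.choose (2 * L) L := by exact_mod_cast h
  rw [pow_succ]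
  field_simp
  linarith

/-- The differential equation `2 (1 - z) T' = T` of `T = (1 - z) ^ (-1 / 2)`. -/
lemma two_mul_one_sub_X_mul_derivative_centralSeries :
    2 * (1 - PowerSeries.X) * PowerSeries.derivative ℚ centralSeries = centralSeries := by
  have h2 : (2 : ℚ⟦X⟧) = PowerSeries.C (2 : ℚ) := (map_ofNat PowerSeries.C 2).symm
  ext L
  rw [mul_assoc, h2, PowerSeries.coeff_C_mul, sub_mul, one_mul, map_sub,
    PowerSeries.coeff_derivative]
  cases L with
  | zero =>
    have := coeff_centralSeries_succ 0
    simp at this ⊢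
    linarith
  | succ L =>
    rw [PowerSeries.coeff_succ_X_mul, PowerSeries.coeff_derivative]
    have := coeff_centralSeries_succ (L + 1)
    push_cast at this ⊢
    linarith

/-- The derivative of the left-hand side vanishes by the differential equation of `centralSeries`. -/
lemma one_sub_X_mul_centralSeries_sq : (1 - PowerSeries.X) * centralSeries ^ 2 = 1 := by
  apply PowerSeries.derivative.ext
  · have h := two_mul_one_sub_X_mul_derivative_centralSeries
    rw [Derivation.leibniz, PowerSeries.derivative_pow, map_sub, PowerSeries.derivative_one,
      PowerSeries.derivative_X]
    simp only [smul_eq_mul]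
    push_cast
    linear_combination centralSeries * h
  · simp [centralSeries]

lemma sqrtSeries_mul_centralSeries : sqrtSeries * centralSeries = 1 := by
  rw [← one_sub_X_mul_centralSeries_sq, sqrtSeries]; ring

lemma sqrtSeries_sq : sqrtSeries ^ 2 = 1 - PowerSeries.X := by
  rw [sqrtSeries]
  linear_combination (1 - PowerSeries.X) * one_sub_X_mul_centralSeries_sq

/-- Comparison of coefficients in `k T ^ (k + 2) = k T ^ k + 2 z (T ^ k)'` for
`T = (1 - z) ^ (-1 / 2)`. -/
lemma coeff_centralSeries_pow_add_two (k L : ℕ) :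
    (k : ℚ) * PowerSeries.coeff L (centralSeries ^ (k + 2)) =
      (k + 2 * L) * PowerSeries.coeff L (centralSeries ^ k) := by
  have h : (PowerSeries.C (k : ℚ)) * centralSeries ^ (k + 2) =
      PowerSeries.C (k : ℚ) * centralSeries ^ k +
        PowerSeries.C (2 : ℚ) *
          (PowerSeries.X * PowerSeries.derivative ℚ (centralSeries ^ k)) := by
    rw [PowerSeries.derivative_pow]
    have h1 := two_mul_one_sub_X_mul_derivative_centralSeries
    have h2 := one_sub_X_mul_centralSeries_sq
    have h3 : 2 * PowerSeries.derivative ℚ centralSeries = centralSeries ^ 3 := by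
      linear_combination centralSeries ^ 2 * h1 -
        2 * PowerSeries.derivative ℚ centralSeries * h2
    cases k with
    | zero => simp
    | succ k =>
      have h4 : (PowerSeries.C ((k + 1 : ℕ) : ℚ) : ℚ⟦X⟧) = ((k + 1 : ℕ) : ℚ⟦X⟧) := by simp
      have h5 : (PowerSeries.C (2 : ℚ) : ℚ⟦X⟧) = 2 := map_ofNat PowerSeries.C 2
      rw [h4, h5, Nat.add_sub_cancel]
      linear_combination ((k + 1 : ℕ) : ℚ⟦X⟧) * centralSeries ^ (k + 1) * h2 -
        ((k + 1 : ℕ) : ℚ⟦X⟧) * centralSeries ^ k * PowerSeries.X * h3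
  have := congrArg (PowerSeries.coeff L) h
  rw [map_add, PowerSeries.coeff_C_mul, PowerSeries.coeff_C_mul, PowerSeries.coeff_C_mul] at this
  rw [this]
  cases L with
  | zero => simp
  | succ L =>
    rw [PowerSeries.coeff_succ_X_mul, PowerSeries.coeff_derivative]
    push_cast
    ring

lemma exists_coeff_centralSeries_pow (k a : ℕ) (hk : 0 < k) : ∃ P : ℚ[X], P.natDegree ≤ a ∧
    ∀ L : ℕ, PowerSeries.coeff L (centralSeries ^ (k + 2 * a)) =
      P.eval (L : ℚ) * PowerSeries.coeff L (centralSeries ^ k) := by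
  induction a with
  | zero => exact ⟨1, by simp, by simp⟩
  | succ a ih =>
    obtain ⟨P, hP, h⟩ := ih
    have hne : ((k + 2 * a : ℕ) : ℚ) ≠ 0 := by positivity
    refine ⟨P * (1 + C (2 / ((k + 2 * a : ℕ) : ℚ)) * X), ?_, fun L => ?_⟩
    · refine natDegree_mul_le.trans (add_le_add hP ?_)
      compute_degree
    · have h1 := coeff_centralSeries_pow_add_two (k + 2 * a) L
      rw [h] at h1
      apply mul_left_cancel₀ hne
      rw [show k + 2 * (a + 1) = k + 2 * a + 2 by ring, h1]
      simp only [eval_mul, eval_add, eval_one, eval_C, eval_X]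
      field_simp

/-- The series whose coefficients have the form `P(L) binom(2 L, L) / 4 ^ L + Q(L)` with polynomials
`P`, `Q` of degree at most `⌈r / 2⌉` and `⌊r / 2⌋`. -/
def centralSpace (r : ℕ) : Submodule ℚ ℚ⟦X⟧ where
  carrier := {f | ∃ P Q : ℚ[X], P.natDegree ≤ (r + 1) / 2 ∧ Q.natDegree ≤ r / 2 ∧
    ∀ L : ℕ, PowerSeries.coeff L f =
      P.eval (L : ℚ) * ((Nat.choose (2 * L) L : ℚ) / 4 ^ L) + Q.eval (L : ℚ)}
  zero_mem' := ⟨0, 0, by simp, by simp, by simp⟩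
  add_mem' := by
    rintro f g ⟨P, Q, hP, hQ, h⟩ ⟨P', Q', hP', hQ', h'⟩
    refine ⟨P + P', Q + Q', natDegree_add_le_of_degree_le hP hP',
      natDegree_add_le_of_degree_le hQ hQ', fun L => ?_⟩
    rw [map_add, h, h', eval_add, eval_add]
    ring
  smul_mem' := by
    rintro c f ⟨P, Q, hP, hQ, h⟩
    refine ⟨c • P, c • Q, (natDegree_smul_le c P).trans hP, (natDegree_smul_le c Q).trans hQ,
      fun L => ?_⟩
    rw [PowerSeries.coeff_smul, h, eval_smul, eval_smul]
    simp only [smul_eq_mul]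
    ring

lemma centralSeries_pow_mem (r k : ℕ) (hk : 1 ≤ k) (hkr : k ≤ r + 2) :
    centralSeries ^ k ∈ centralSpace r := by
  rcases Nat.even_or_odd' k with ⟨a, rfl | rfl⟩
  · obtain ⟨Q, hQ, h⟩ := exists_coeff_centralSeries_pow 2 (a - 1) two_pos
    refine ⟨0, Q, by simp, by omega, fun L => ?_⟩
    rw [show 2 * a = 2 + 2 * (a - 1) by omega, h]
    -- both sides are inverse to `1 - z`
    have h2 : centralSeries ^ 2 = PowerSeries.mk 1 :=
      mul_left_cancel₀ (sub_ne_zero.mpr fun h0 => by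
          simpa using congrArg PowerSeries.constantCoeff h0)
        (one_sub_X_mul_centralSeries_sq.trans
          ((mul_comm _ _).trans (PowerSeries.mk_one_mul_one_sub_eq_one ℚ)).symm)
    simp [h2]
  · obtain ⟨P, hP, h⟩ := exists_coeff_centralSeries_pow 1 a one_pos
    refine ⟨P, 0, by omega, by simp, fun L => ?_⟩
    rw [add_comm, h]
    simp [centralSeries]

/-- Degree `r + 2` is excluded for `p` because `s ^ (r + 2) t ^ (r + 2) = 1` is not in the
space: its coefficients `1, 0, 0, …` are not of the required form. -/
lemma aeval_sqrtSeries_mul_pow_mem (r : ℕ) (p : ℚ[X]) (hp : p.natDegree ≤ r + 1) :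
    aeval sqrtSeries p * centralSeries ^ (r + 2) ∈ centralSpace r := by
  rw [aeval_eq_sum_range, Finset.sum_mul]
  refine Submodule.sum_mem _ fun i hi => ?_
  have hi : i ≤ r + 1 := by have := Finset.mem_range.mp hi; omega
  rw [smul_mul_assoc]
  refine Submodule.smul_mem _ _ ?_
  have : sqrtSeries ^ i * centralSeries ^ (r + 2) = centralSeries ^ (r + 2 - i) := by
    rw [show r + 2 = i + (r + 2 - i) by omega, pow_add, ← mul_assoc, ← mul_pow,
      sqrtSeries_mul_centralSeries, one_pow, one_mul]
    congr 1
    omega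
  rw [this]
  exact centralSeries_pow_mem r _ (by omega) (by omega)

/-! ### Generating functions of walks with chosen marked steps -/

/-- The substitution `z = x²`. -/
def squareVar : ℚ⟦X⟧ →ₐ[ℚ] ℚ⟦X⟧ := PowerSeries.expand 2 two_ne_zero

/-- The series `t = (1 - x²) ^ (-1 / 2)`, the generating function of walks returning to their
starting point, with weight `x / 2` per step. -/
def returnSeries : ℚ⟦X⟧ := squareVar centralSeries

/-- The series `s = √(1 - x²)`. -/
def rootSeries : ℚ⟦X⟧ := squareVar sqrtSeries

/-- The series `c = (1 - s) / x`, the generating function of first passages from `1` to `0`, with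
weight `x / 2` per step. -/
def passageSeries : ℚ⟦X⟧ := PowerSeries.mk fun n => PowerSeries.coeff (n + 1) (1 - rootSeries)

lemma rootSeries_mul_returnSeries : rootSeries * returnSeries = 1 := by
  rw [rootSeries, returnSeries, ← map_mul, sqrtSeries_mul_centralSeries, map_one]

lemma rootSeries_sq : rootSeries ^ 2 = 1 - PowerSeries.X ^ 2 := by
  rw [rootSeries, ← map_pow, sqrtSeries_sq, map_sub, map_one, squareVar, PowerSeries.expand_X]

lemma X_mul_passageSeries : PowerSeries.X * passageSeries = 1 - rootSeries := by
  ext n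
  cases n with
  | zero =>
    simp [rootSeries, squareVar, sqrtSeries, centralSeries]
  | succ n => rw [PowerSeries.coeff_succ_X_mul, passageSeries, PowerSeries.coeff_mk]

lemma X_mul_passageSeries_sq_add_one :
    PowerSeries.X * (passageSeries ^ 2 + 1) = 2 * passageSeries := by
  apply mul_left_cancel₀ (PowerSeries.X_ne_zero (R := ℚ))
  linear_combination (PowerSeries.X * passageSeries + 1 - rootSeries - 2) * X_mul_passageSeries +
    rootSeries_sq

/-- The generating function of walks from `j` to `0`, with weight `x / 2` per step. -/
def greenSeries (j : ℤ) : ℚ⟦X⟧ := returnSeries * passageSeries ^ j.natAbs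

/-- First-step analysis of the walks from `j` to `0`. -/
lemma two_mul_greenSeries (j : ℤ) :
    2 * greenSeries j = (if j = 0 then 2 else 0) +
      PowerSeries.X * (greenSeries (j + 1) + greenSeries (j - 1)) := by
  have h := X_mul_passageSeries_sq_add_one
  simp only [greenSeries]
  rcases lt_trichotomy j 0 with hj | rfl | hj
  · obtain ⟨k, rfl⟩ : ∃ k : ℕ, j = -(k + 1) := ⟨(-j - 1).toNat, by omega⟩
    rw [if_neg hj.ne, show (-((k : ℤ) + 1)).natAbs = k + 1 by omega,
      show (-((k : ℤ) + 1) + 1).natAbs = k by omega,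
      show (-((k : ℤ) + 1) - 1).natAbs = k + 2 by omega]
    linear_combination -returnSeries * passageSeries ^ k * h
  · simp only [Int.natAbs_zero, zero_add, zero_sub, Int.natAbs_neg, Int.natAbs_one, if_true]
    linear_combination 2 * rootSeries_mul_returnSeries - 2 * returnSeries * X_mul_passageSeries
  · obtain ⟨k, rfl⟩ : ∃ k : ℕ, j = k + 1 := ⟨(j - 1).toNat, by omega⟩
    rw [if_neg hj.ne', show ((k : ℤ) + 1).natAbs = k + 1 by omega,
      show ((k : ℤ) + 1 + 1).natAbs = k + 2 by omega,
      show ((k : ℤ) + 1 - 1).natAbs = k by omega]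
    linear_combination -returnSeries * passageSeries ^ k * h

/-- The generating function, with weight `x / 2` per step, of walks from `j` together with a choice of
`r` marked steps. The first chosen step leads from `0` to `1` or from `1` to `2`, and the rest of the
walk starts at `1` or `2`. -/
def markedSeries : ℕ → ℤ → ℚ⟦X⟧
  | 0, _ => PowerSeries.mk 1
  | r + 1, j => PowerSeries.C 2⁻¹ * PowerSeries.X *
      (greenSeries j * markedSeries r 1 + greenSeries (j - 1) * markedSeries r 2)

lemma two_mul_markedSeries_zero (j : ℤ) :
    2 * markedSeries 0 j = 2 +
      PowerSeries.X * (markedSeries 0 (j + 1) + markedSeries 0 (j - 1)) := by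
  simp only [markedSeries]
  linear_combination 2 * PowerSeries.mk_one_mul_one_sub_eq_one ℚ

/-- First-step analysis: the first step may be the first chosen one if it goes up from `0` or `1`. -/
lemma two_mul_markedSeries_succ (r : ℕ) (j : ℤ) :
    2 * markedSeries (r + 1) j =
      PowerSeries.X * (markedSeries (r + 1) (j + 1) + markedSeries (r + 1) (j - 1) +
        if j = 0 ∨ j = 1 then markedSeries r (j + 1) else 0) := by
  have h0 := two_mul_greenSeries j
  have h1 := two_mul_greenSeries (j - 1)
  have hC : (2 : ℚ⟦X⟧) * PowerSeries.C 2⁻¹ = 1 := by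
    rw [← map_ofNat PowerSeries.C 2, ← map_mul]; norm_num
  have key : (if j = 0 ∨ j = 1 then markedSeries r (j + 1) else 0) =
      PowerSeries.C 2⁻¹ * ((if j = 0 then 2 else 0) * markedSeries r 1 +
        (if j - 1 = 0 then 2 else 0) * markedSeries r 2) := by
    by_cases a : j = 0
    · subst a; simp; linear_combination -markedSeries r 1 * hC
    · by_cases b : j = 1
      · subst b; simp; linear_combination -markedSeries r 2 * hC
      · simp [a, b, sub_eq_zero]
  rw [key]
  simp only [markedSeries]
  rw [show j + 1 - 1 = j - 1 + 1 by ring]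
  linear_combination PowerSeries.C 2⁻¹ * PowerSeries.X * markedSeries r 1 * h0 +
    PowerSeries.C 2⁻¹ * PowerSeries.X * markedSeries r 2 * h1

/-- The square of `t` is `1 / (1 - x²)`, which turns `1 / (1 - x)` into `(1 + x) t²`; the right-hand
side is then sorted by parity in `x`. -/
lemma X_mul_one_add_passageSeries_mul_geom :
    PowerSeries.X * (1 + passageSeries) * PowerSeries.mk 1 =
      returnSeries ^ 2 * (PowerSeries.X * (2 - rootSeries) +
        (1 - rootSeries) * (2 + rootSeries)) := by
  have hg := PowerSeries.mk_one_mul_one_sub_eq_one ℚ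
  have ht : returnSeries ^ 2 * (1 - PowerSeries.X ^ 2) = 1 := by
    linear_combination -returnSeries ^ 2 * rootSeries_sq +
      (rootSeries * returnSeries + 1) * rootSeries_mul_returnSeries
  have hg' : PowerSeries.mk 1 = returnSeries ^ 2 * (1 + PowerSeries.X) := by
    linear_combination -PowerSeries.mk 1 * ht + returnSeries ^ 2 * (1 + PowerSeries.X) * hg
  rw [hg']
  linear_combination returnSeries ^ 2 * (1 + PowerSeries.X) * X_mul_passageSeries +
    returnSeries ^ 2 * rootSeries_sq

/-- The closed form after a step to `1`; each further chosen step contributes a factor `(1 - s) t`, the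
nonzero eigenvalue of the rank-one transfer matrix. -/
lemma two_mul_markedSeries_one_succ (r : ℕ) :
    2 * markedSeries (r + 1) 1 = returnSeries ^ (r + 3) * (1 - rootSeries) ^ r *
      (PowerSeries.X * (2 - rootSeries) + (1 - rootSeries) * (2 + rootSeries)) ∧
    markedSeries (r + 1) 2 = passageSeries * markedSeries (r + 1) 1 := by
  have hC : (2 : ℚ⟦X⟧) * PowerSeries.C 2⁻¹ = 1 := by
    rw [← map_ofNat PowerSeries.C 2, ← map_mul]; norm_num
  have h2 : ∀ r, markedSeries (r + 1) 2 = passageSeries * markedSeries (r + 1) 1 := fun r => by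
    simp [markedSeries, greenSeries]; ring
  refine ⟨?_, h2 r⟩
  induction r with
  | zero =>
    simp only [markedSeries, greenSeries]
    simp
    linear_combination returnSeries * X_mul_one_add_passageSeries_mul_geom +
      hC * (PowerSeries.X * returnSeries * (1 + passageSeries) * PowerSeries.mk 1)
  | succ r ih =>
    have : markedSeries (r + 2) 1 = (1 - rootSeries) * returnSeries * markedSeries (r + 1) 1 := by
      rw [markedSeries, h2]
      simp [greenSeries]
      linear_combination PowerSeries.X * returnSeries * passageSeries *
        markedSeries (r + 1) 1 * hC + returnSeries * markedSeries (r + 1) 1 * X_mul_passageSeries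
    rw [this]
    linear_combination (1 - rootSeries) * returnSeries * ih

lemma squareVar_aeval_mul_pow (p : ℚ[X]) (k : ℕ) :
    squareVar (aeval sqrtSeries p * centralSeries ^ k) = aeval rootSeries p * returnSeries ^ k := by
  rw [map_mul, map_pow, ← aeval_algHom_apply]
  rfl

/-- The walks from `0`, sorted by parity: `f` belongs to even and `g` to odd lengths. The constant `c`
absorbs the power `t ^ 0`, which occurs for `r ≤ 1`. -/
lemma exists_X_mul_markedSeries_eq (r : ℕ) : ∃ f ∈ centralSpace r, ∃ g ∈ centralSpace r, ∃ c : ℚ,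
    PowerSeries.X * markedSeries r 0 =
      PowerSeries.X * squareVar f + squareVar g + PowerSeries.C c := by
  have hC : (2 : ℚ⟦X⟧) * PowerSeries.C 2⁻¹ = 1 := by
    rw [← map_ofNat PowerSeries.C 2, ← map_mul]; norm_num
  have hc : ∀ q : ℚ, aeval rootSeries (Polynomial.C q) = PowerSeries.C q := fun q => aeval_C _ q
  have hst := rootSeries_mul_returnSeries
  have hs := rootSeries_sq
  have hk := X_mul_passageSeries
  match r with
  | 0 =>
    -- `x / (1 - x) = x t² + t² - 1`
    have hT : centralSeries ^ 2 ∈ centralSpace 0 := centralSeries_pow_mem 0 2 (by simp) le_rfl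
    refine ⟨_, hT, _, hT, -1, ?_⟩
    have hg := PowerSeries.mk_one_mul_one_sub_eq_one ℚ
    rw [map_pow, map_neg, map_one]
    change PowerSeries.X * PowerSeries.mk 1 =
      PowerSeries.X * returnSeries ^ 2 + returnSeries ^ 2 + -1
    have ht : returnSeries ^ 2 * (1 - PowerSeries.X ^ 2) = 1 := by
      linear_combination -returnSeries ^ 2 * hs + (rootSeries * returnSeries + 1) * hst
    linear_combination -PowerSeries.X * PowerSeries.mk 1 * ht +
      (returnSeries ^ 2 * (1 + PowerSeries.X) * PowerSeries.X) * hg - ht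
  | 1 =>
    -- `½ t³ (2 - s) x² = ½ t³ (2 - s - 2 s²) + ½`, since `x² = 1 - s²` and `s t = 1`
    refine ⟨_, aeval_sqrtSeries_mul_pow_mem 1 (C 2⁻¹ * ((1 - X) * (2 + X))) ?_,
      _, aeval_sqrtSeries_mul_pow_mem 1 (C 2⁻¹ * (2 - X - 2 * X ^ 2)) ?_, 2⁻¹, ?_⟩
    · compute_degree
    · compute_degree
    · simp only [squareVar_aeval_mul_pow]
      simp only [map_mul, map_sub, map_add, map_one, map_ofNat, map_pow, aeval_X, hc]
      simp only [markedSeries, greenSeries]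
      simp
      linear_combination PowerSeries.C 2⁻¹ * PowerSeries.X * returnSeries *
          X_mul_one_add_passageSeries_mul_geom +
        PowerSeries.C 2⁻¹ * returnSeries ^ 3 * (2 - rootSeries) * hs +
        PowerSeries.C 2⁻¹ * (rootSeries ^ 2 * returnSeries ^ 2 + rootSeries * returnSeries + 1) * hst
  | r + 2 =>
    have hd : ∀ a : ℕ, ((1 - X : ℚ[X]) ^ a).natDegree ≤ a := fun a => by
      simpa using natDegree_pow_le_of_le a (show (1 - X : ℚ[X]).natDegree ≤ 1 by compute_degree)
    refine ⟨_, aeval_sqrtSeries_mul_pow_mem (r + 2) (C 2⁻¹ * ((1 - X) ^ (r + 1) * (2 - X))) ?_,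
      _, aeval_sqrtSeries_mul_pow_mem (r + 2) (C 2⁻¹ * ((1 - X) ^ (r + 2) * (2 + X))) ?_, 0, ?_⟩
    · refine (natDegree_C_mul_le _ _).trans 
        ((natDegree_mul_le_of_le (n := 1) (hd (r + 1)) ?_).trans (by omega))
      compute_degree
    · refine (natDegree_C_mul_le _ _).trans 
        ((natDegree_mul_le_of_le (n := 1) (hd (r + 2)) ?_).trans (by omega))
      compute_degree
    · simp only [squareVar_aeval_mul_pow]
      simp only [map_mul, map_sub, map_add, map_one, map_ofNat, map_pow, aeval_X, hc, map_zero]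
      obtain ⟨h1, h2⟩ := two_mul_markedSeries_one_succ r
      rw [markedSeries, h2]
      simp [greenSeries]
      linear_combination PowerSeries.C 2⁻¹ * returnSeries * PowerSeries.X *
          markedSeries (r + 1) 1 * X_mul_passageSeries_sq_add_one +
        PowerSeries.C 2⁻¹ * returnSeries * PowerSeries.X * passageSeries * h1 +
        PowerSeries.C 2⁻¹ * returnSeries ^ (r + 4) * (1 - rootSeries) ^ r *
          (PowerSeries.X * (2 - rootSeries) + (1 - rootSeries) * (2 + rootSeries)) * hk

/-! ### Counting walks -/

lemma exists_coeff_markedSeries_eq (r : ℕ) : ∃ f ∈ centralSpace r, ∃ g ∈ centralSpace r,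
    ∀ L : ℕ, PowerSeries.coeff (2 * L) (markedSeries r 0) = PowerSeries.coeff L f ∧
      PowerSeries.coeff (2 * L + 1) (markedSeries r 0) = PowerSeries.coeff (L + 1) g := by
  obtain ⟨f, hf, g, hg, c, h⟩ := exists_X_mul_markedSeries_eq r
  refine ⟨f, hf, g, hg, fun L => ⟨?_, ?_⟩⟩ <;>
    rw [← PowerSeries.coeff_succ_X_mul, h, map_add, map_add, PowerSeries.coeff_succ_X_mul,
      PowerSeries.coeff_C, if_neg (Nat.succ_ne_zero _), add_zero, squareVar]
  · rw [PowerSeries.coeff_expand_mul, PowerSeries.coeff_expand_of_not_dvd 2 _ _ (by omega), add_zero]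
  · rw [PowerSeries.coeff_expand_of_not_dvd 2 _ _ (by omega), zero_add,
      show 2 * L + 1 + 1 = 2 * (L + 1) by ring, PowerSeries.coeff_expand_mul]

/-- The sum over all walks of length `m` from `j` of `(1 + y) ^ (number of marked steps)`, a polynomial
in `y`. -/
def walkPolynomial : ℕ → ℤ → ℚ[X]
  | 0, _ => 1
  | m + 1, j => walkPolynomial m (j - 1) +
      (if j = 0 ∨ j = 1 then 1 + X else 1) * walkPolynomial m (j + 1)

lemma coeff_walkPolynomial (m r : ℕ) (j : ℤ) :
    (walkPolynomial m j).coeff r = 2 ^ m * PowerSeries.coeff m (markedSeries r j) := by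
  induction m generalizing r j with
  | zero =>
    cases r with
    | zero => simp [walkPolynomial, markedSeries]
    | succ r => simp [walkPolynomial, markedSeries, coeff_one]
  | succ m ih =>
    have h2 : (2 : ℚ⟦X⟧) = PowerSeries.C (2 : ℚ) := (map_ofNat PowerSeries.C 2).symm
    cases r with
    | zero =>
      have h := congrArg (PowerSeries.coeff (m + 1)) (two_mul_markedSeries_zero j)
      rw [h2, map_add, PowerSeries.coeff_C_mul, PowerSeries.coeff_succ_X_mul, map_add,
        PowerSeries.coeff_C, if_neg (Nat.succ_ne_zero _), zero_add] at h
      rw [pow_succ, mul_assoc, h, mul_add, ← ih, ← ih, walkPolynomial, coeff_add]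
      split_ifs <;> simp [add_mul, add_comm]
    | succ r =>
      have h := congrArg (PowerSeries.coeff (m + 1)) (two_mul_markedSeries_succ r j)
      rw [h2, PowerSeries.coeff_C_mul, PowerSeries.coeff_succ_X_mul, map_add, map_add] at h
      rw [pow_succ, mul_assoc, h, mul_add, mul_add, ← ih, ← ih, walkPolynomial, coeff_add]
      split_ifs
      · rw [← ih]
        simp only [add_mul, one_mul, coeff_add, coeff_X_mul]
        ring
      · simp only [one_mul, map_zero, mul_zero]
        ring

/-- The indicator `Y_i` as a function of the interleaving alone: the cut is the size of `S`, and it does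
not enter for a card of the first sequence. -/
def topMark (S : Finset ℕ) (i : ℕ) : ℕ := if #{q ∈ S | q ≤ i} = topGuess i ∧ i ∈ S then 1 else 0

lemma indicatorY_eq_topMark (n i t : ℕ) (S : Finset ℕ) :
    indicatorY n i ⟨t, S⟩ = topMark S i := by
  by_cases h : i ∈ S <;> simp [indicatorY, topMark, cardAt, h]

lemma totalC_prod_indicatorY (n : ℕ) (I : Finset ℕ) :
    totalC n (fun ω => ∏ i ∈ I, indicatorY n i ω) =
      ∑ S ∈ (Icc 1 n).powerset, ∏ i ∈ I, topMark S i := by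
  simp only [totalC, riffleOutcomes, sum_sigma, indicatorY_eq_topMark, sum_powerset,
    Nat.card_Icc, Nat.add_sub_cancel]

lemma topMark_insert_of_lt {S : Finset ℕ} {a i : ℕ} (h : i < a) :
    topMark (insert a S) i = topMark S i := by
  simp only [topMark, filter_insert, if_neg h.not_ge, mem_insert, h.ne, false_or]

/-- An up-step at time `h + 1` is marked exactly if the walk is at `0` or `1` at time `h`. -/
lemma topMark_insert_succ {S : Finset ℕ} {h : ℕ} (hS : S ⊆ Icc 1 h) :
    topMark (insert (h + 1) S) (h + 1) =
      if 2 * (#S : ℤ) - h = 0 ∨ 2 * (#S : ℤ) - h = 1 then 1 else 0 := by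
  have hn : h + 1 ∉ S := fun hh => by have := mem_Icc.mp (hS hh); omega
  have hf : {q ∈ insert (h + 1) S | q ≤ h + 1} = insert (h + 1) S := by
    refine filter_true_of_mem fun q hq => ?_
    rcases mem_insert.mp hq with rfl | hq
    · rfl
    · have := mem_Icc.mp (hS hq); omega
  rw [topMark, hf, card_insert_of_notMem hn, topGuess]
  refine if_congr ?_ rfl rfl
  simp only [mem_insert_self, and_true]
  omega

lemma sum_powerset_Icc_succ {M : Type*} [AddCommMonoid M] (h : ℕ) (F : Finset ℕ → M) :
    ∑ S ∈ (Icc 1 (h + 1)).powerset, F S =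
      ∑ S ∈ (Icc 1 h).powerset, (F S + F (insert (h + 1) S)) := by
  rw [← insert_Icc_right_eq_Icc_add_one (by omega), sum_powerset_insert (by simp),
    sum_add_distrib]

/-- Walks of length `h + m` are continuations, by `m` steps, of walks of length `h`. -/
lemma sum_prod_topMark_eq_walkPolynomial (m h : ℕ) :
    ∑ S ∈ (Icc 1 (h + m)).powerset, ∏ i ∈ Icc 1 (h + m), (1 + X * C (topMark S i : ℚ)) =
      ∑ S ∈ (Icc 1 h).powerset, (∏ i ∈ Icc 1 h, (1 + X * C (topMark S i : ℚ))) *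
        walkPolynomial m (2 * #S - h) := by
  induction m generalizing h with
  | zero => simp [walkPolynomial]
  | succ m ih =>
    rw [show h + (m + 1) = h + 1 + m by ring, ih (h + 1), sum_powerset_Icc_succ]
    refine sum_congr rfl fun S hS => ?_
    have hS := mem_powerset.mp hS
    have hn : h + 1 ∉ S := fun hh => by have := mem_Icc.mp (hS hh); omega
    have h0 : topMark S (h + 1) = 0 := by simp [topMark, hn]
    have h1 : ∏ i ∈ Icc 1 h, (1 + X * C (topMark (insert (h + 1) S) i : ℚ)) =
        ∏ i ∈ Icc 1 h, (1 + X * C (topMark S i : ℚ)) :=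
      prod_congr rfl fun i hi => by
        rw [topMark_insert_of_lt (Nat.lt_succ_of_le (mem_Icc.mp hi).2)]
    rw [prod_Icc_succ_top (by omega), prod_Icc_succ_top (by omega), h0, h1,
      topMark_insert_succ hS, card_insert_of_notMem hn, walkPolynomial,
      show 2 * ((#S : ℤ)) - ((h + 1 : ℕ) : ℤ) = 2 * #S - h - 1 by push_cast; ring,
      show 2 * ((#S + 1 : ℕ) : ℤ) - ((h + 1 : ℕ) : ℤ) = 2 * #S - h + 1 by push_cast; ring,
      Nat.cast_zero, C_0, mul_zero, add_zero, mul_one, mul_assoc, mul_add]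
    split_ifs <;> simp

lemma coeff_sum_prod_topMark (h r : ℕ) :
    (∑ S ∈ (Icc 1 h).powerset, ∏ i ∈ Icc 1 h, (1 + X * C (topMark S i : ℚ))).coeff r =
      ∑ I ∈ powersetCard r (Icc 1 h), ∑ S ∈ (Icc 1 h).powerset, ∏ i ∈ I, (topMark S i : ℚ) := by
  rw [finsetSum_coeff, sum_comm]
  refine sum_congr rfl fun S _ => ?_
  rw [prod_one_add, finsetSum_coeff, powersetCard_eq_filter, sum_filter]
  refine sum_congr rfl fun I _ => ?_
  rw [prod_mul_distrib, prod_const, ← map_prod, coeff_mul_C, coeff_X_pow]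
  by_cases hI : #I = r
  · simp [hI]
  · simp [hI, Ne.symm hI]


lemma sum_powerset_Icc_prod_topMark {h n : ℕ} (hn : h ≤ n) {I : Finset ℕ} (hI : I ⊆ Icc 1 h) :
    ∑ S ∈ (Icc 1 n).powerset, ∏ i ∈ I, topMark S i =
      2 ^ (n - h) * ∑ S ∈ (Icc 1 h).powerset, ∏ i ∈ I, topMark S i := by
  induction n, hn using Nat.le_induction with
  | base => simp
  | succ n hn ih =>
    rw [sum_powerset_Icc_succ, Nat.succ_sub hn, pow_succ, mul_right_comm, ← ih, sum_mul]
    refine sum_congr rfl fun S _ => ?_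
    rw [prod_congr rfl fun i hi => topMark_insert_of_lt (S := S) (a := n + 1)
      (Nat.lt_succ_of_le ((mem_Icc.mp (hI hi)).2.trans hn))]
    ring

lemma sum_totalC_eq_coeff_markedSeries (n r : ℕ) :
    ((∑ I ∈ powersetCard r (Icc 1 (topHalf n)),
        totalC n (fun ω => ∏ i ∈ I, indicatorY n i ω) : ℕ) : ℚ) =
      2 ^ n * PowerSeries.coeff (topHalf n) (markedSeries r 0) := by
  have hn : topHalf n ≤ n := by rw [topHalf]; omega
  have h := sum_prod_topMark_eq_walkPolynomial (topHalf n) 0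
  simp only [zero_add] at h
  have h' := congrArg (Polynomial.coeff · r) h
  simp only [coeff_sum_prod_topMark] at h'
  simp [coeff_walkPolynomial] at h'
  rw [← Nat.sub_add_cancel hn, pow_add, Nat.sub_add_cancel hn, mul_assoc, ← h', mul_sum]
  push_cast
  refine sum_congr rfl fun I hI => ?_
  rw [totalC_prod_indicatorY, sum_powerset_Icc_prod_topMark hn (mem_powersetCard.mp hI).1]
  push_cast
  rfl

end

theorem mainTheorem2 (r : ℕ) (ε : Fin 2) :
    ∃ P Q : ℚ[X], P.natDegree ≤ (r + 1) / 2 ∧ Q.natDegree ≤ r / 2 ∧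
      ∀ n h L : ℕ, h = topHalf n → h % 2 = (ε : ℕ) → L = (h + 1) / 2 →
        ((∑ I ∈ powersetCard r (Icc 1 h), totalC n (fun ω => ∏ i ∈ I, indicatorY n i ω) : ℕ) : ℚ) =
          2 ^ n * (P.eval (L : ℚ) * ((Nat.choose (2 * L) L : ℚ) / 4 ^ L) + Q.eval (L : ℚ)) := by
  obtain ⟨f, ⟨P, Q, hP, hQ, hf⟩, g, ⟨P', Q', hP', hQ', hg⟩, h⟩ := exists_coeff_markedSeries_eq r
  rcases ε with ⟨_ | _ | _, hε⟩
  · refine ⟨P, Q, hP, hQ, ?_⟩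
    rintro n _ L rfl hmod hL
    simp only at hmod
    rw [sum_totalC_eq_coeff_markedSeries, show topHalf n = 2 * L by omega, (h L).1, hf]
  · refine ⟨P', Q', hP', hQ', ?_⟩
    rintro n _ L rfl hmod hL
    simp only at hmod
    rw [sum_totalC_eq_coeff_markedSeries, show topHalf n = 2 * (L - 1) + 1 by omega, (h _).2,
      Nat.sub_add_cancel (by omega), hg]
  · omega
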